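/- **Setting.** Let $G=(V,E)$ be an undirected graph (loops, multiple edges, infinite $V$, $E$ and infinite degrees allowed) with edge lengths $\ell_e>0$, edge weights $a_e>0$, vertex masses $\mathcal V(v)>0$ and a specified set of boundary vertices $\partial\mathcal G\subset V$. Let $\mathcal G$ be its geometric realization (an interval of length $\ell_e$ for each edge) with the path metric, $\mathcal V$ the measure on $\mathcal G$ with point masses $\mathcal V(v)$ at the vertices, and $\mathcal E$ the measure equal to $a_e$ times Lebesgue measure on the interior $e^\circ$ of each edge $e$ and to $0$ on vertices. Norms $\|f\|_p$ of functions are taken in $L^p(\mathcal V)$, norms of $\nabla f$ in $L^p(\mathcal E)$. A subset of $\mathcal G$ is of finite type if it lies in a union of finitely many vertices and closed edges. $C^1_{\rm Dir}(\mathcal G)$ is the set of continuous $f\colon\mathcal G\to\mathbb R$ that are differentiable with uniformly continuous derivative on each edge interior, whose support is of finite type, and that vanish on $\partial\mathcal G$. Put $$\rho_{\sup}=\sup_{v\in V}\ \frac1{\mathcal V(v)}\sum_{e\ni v}\frac{a_e\ell_e}2 .$$ A set $\Omega\subset\mathcal G$ is admissible if it is open, of finite type, disjoint from $\partial\mathcal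 G$, and has finite topological boundary $\partial\Omega$. Its boundary area $\mathcal A(\partial\Omega)$ is the sum of $a_e$ over all non-vertex points of $\partial\Omega$ ($e$ being the edge containing the point), plus, for each vertex $v\in\partial\Omega$, the sum of $a_e$ over all edges $e$ with $v\in\overline{\Omega\cap e^\circ}$. For $1\le\nu\le\infty$ set $$I_\nu=\inf_{\Omega\text{ admissible}}\frac{\mathcal A(\partial\Omega)}{\mathcal V(\Omega)^{1-1/\nu}},\qquad \widetilde I_\nu=\inf_{\Omega\text{ admissible}}\frac{\mathcal A(\partial\Omega)}{\min(\mathcal V(\Omega),\mathcal V(\mathcal G\setminus\Omega))^{1-1/\nu}},$$ where a quotient is $+\infty$ if $\mathcal V(\Omega)=0$, respectively if the minimum is $0$. The graph is closed if $V$ and $E$ are finite and $\partial\mathcal G=\emptyset$. A function $f$ is split if $\mathcal V(\{f>0\})$ and $\mathcal V(\{f<0\})$ are both at most $\mathcal V(\mathcal G)/2$. **Theorem.** Let $2<\nu\le\infty$ (with $2/\nu=0$ if $\nu=\infty$). All quantities are in $[0,\infty]$, with $0\cdot\infty=0$. 1. For every $f\in C^1_{\rm Dir}(\mathcal G)$,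 $$\|\nabla f\|_2\ \ge\ \tfrac12\, I_\nu\,\rho_{\sup}^{-1/2}\,\|f\|_2^{1+2/\nu}\,\|f\|_1^{-2/\nu}.$$ 2. If $\mathcal G$ is closed, then for every split $f\in C^1_{\rm Dir}(\mathcal G)$, $$\|\nabla f\|_2\ \ge\ \tfrac12\, \widetilde I_\nu\,\rho_{\sup}^{-1/2}\,\|f\|_2^{1+2/\nu}\,\|f\|_1^{-2/\nu}.$$ 3. If $\mathcal G$ is closed, then the inequality in 2 holds for every $f\in C^1_{\rm Dir}(\mathcal G)$ with $\int f\,d\mathcal V=0$. -/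

import Mathlib

open MeasureTheory
open scoped ENNReal

noncomputable section

/-- An undirected graph with vertex set `V` and edge set `E` (loops and multiple edges allowed, no
finiteness or countability assumed), with edge lengths `ℓ_e`, a boundary (a specified set of
vertices), vertex masses `𝒱(v)` and edge weights `a_e`.  The edge `e` joins `src e` and `tgt e`;
their order only serves to parametrize the edge and is irrelevant otherwise. -/
structure MetricGraph (V E : Type*) where
  src : E → V
  tgt : E → V
  len : E → ℝ
  len_pos : ∀ e, 0 < len e
  bdry : Set V
  vmass : V → ℝ
  vmass_pos : ∀ v, 0 < vmass v
  weight : E → ℝ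
  weight_pos : ∀ e, 0 < weight e

namespace MetricGraph

variable {V E : Type*}

/-- The points of the geometric realization: the vertices, and for each edge the points of an open
interval of length `ℓ_e` (the edge interior). -/
inductive Point (G : MetricGraph V E) where
  | vertex (v : V) : Point G
  | inner (e : E) (t : ℝ) (ht : t ∈ Set.Ioo 0 (G.len e)) : Point G

variable (G : MetricGraph V E)

open Classical in
/-- The parametrization by arc length of the closed edge `e`, from `src e` at `t = 0` to `tgt e` at
`t = ℓ_e` (constant outside `[0, ℓ_e]`). -/
def pt (e : E) (t : ℝ) : G.Point :=
  if h : t ∈ Set.Ioo 0 (G.len e) then .inner e t h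
  else if t ≤ 0 then .vertex (G.src e) else .vertex (G.tgt e)

/-- `HasPath x y c`: there is a path of length `c` from `x` to `y`, that is, a finite concatenation
of segments of closed edges. -/
inductive HasPath (x : G.Point) : G.Point → ℝ≥0∞ → Prop
  | refl : HasPath x x 0
  | step (c : ℝ≥0∞) (e : E) (s t : ℝ)
      (hs : s ∈ Set.Icc 0 (G.len e)) (ht : t ∈ Set.Icc 0 (G.len e)) :
      HasPath x (G.pt e s) c → HasPath x (G.pt e t) (c + edist s t)

variable {G} in
theorem HasPath.trans {x y z : G.Point} {c d : ℝ≥0∞} (h : G.HasPath x y c)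
    (h' : G.HasPath y z d) : G.HasPath x z (c + d) := by
  induction h' with
  | refl => simpa using h
  | step d e s t hs ht _ ih => rw [← add_assoc]; exact .step _ e s t hs ht ih

variable {G} in
theorem HasPath.symm {x y : G.Point} {c : ℝ≥0∞} (h : G.HasPath x y c) : G.HasPath y x c := by
  induction h with
  | refl => exact .refl
  | step c e s t hs ht _ ih =>
    have h1 := HasPath.step 0 e t s ht hs (HasPath.refl (G := G) (x := G.pt e t))
    have h2 := h1.trans ih
    rwa [zero_add, edist_comm, add_comm] at h2

/-- The path metric of the geometric realization: the infimum of the lengths of the paths from `x`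
to `y` (`∞` between different connected components). -/
instance : PseudoEMetricSpace G.Point where
  edist x y := ⨅ (c : ℝ≥0∞) (_ : G.HasPath x y c), c
  edist_self x := le_antisymm (iInf₂_le 0 .refl) zero_le
  edist_comm x y := le_antisymm
    (le_iInf₂ fun c h => iInf₂_le c h.symm) (le_iInf₂ fun c h => iInf₂_le c h.symm)
  edist_triangle x y z := by
    simp only [ENNReal.iInf_add, ENNReal.add_iInf]
    exact le_iInf₂ fun c h => le_iInf₂ fun d h' => iInf₂_le (d + c) (h'.trans h)

/-- A set is measurable when its trace on each edge is a Borel set. -/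
instance : MeasurableSpace G.Point := ⨅ e, (borel ℝ).map (G.pt e)

/-- The vertex measure `𝒱`: the point mass `𝒱(v) > 0` at each vertex `v`. -/
def vertexMeasure : Measure G.Point :=
  Measure.sum fun v => ENNReal.ofReal (G.vmass v) • Measure.dirac (.vertex v)

/-- The edge measure `ℰ`: on each edge interior it is `a_e` times Lebesgue measure, and it does not
charge the vertices. -/
def edgeMeasure : Measure G.Point :=
  Measure.sum fun e => ENNReal.ofReal (G.weight e) •
    (volume.restrict (Set.Ioo 0 (G.len e))).map (G.pt e)

/-- The half-degree `ρ(v) = 𝒱(v)⁻¹ ∑_{e ∋ v} ℰ(e) / 2`, where `ℰ(e) = a_e ℓ_e`. -/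
def halfDegree (v : V) : ℝ≥0∞ :=
  (ENNReal.ofReal (G.vmass v))⁻¹ *
    ∑' e : {e : E // G.src e = v ∨ G.tgt e = v}, ENNReal.ofReal (G.weight e * G.len e) / 2

/-- `ρ_sup`. -/
def rhoSup : ℝ≥0∞ := ⨆ v, G.halfDegree v

/-- The boundary `∂𝒢`, as a set of points. -/
def boundary : Set G.Point := Point.vertex '' G.bdry

def edgeInterior (e : E) : Set G.Point := G.pt e '' Set.Ioo 0 (G.len e)

def closedEdge (e : E) : Set G.Point := G.pt e '' Set.Icc 0 (G.len e)

/-- `S` lies in the union of finitely many vertices and (closed) edges. -/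
def FiniteType (S : Set G.Point) : Prop :=
  ∃ (A : Set V) (B : Set E), A.Finite ∧ B.Finite ∧
    S ⊆ (Point.vertex '' A : Set G.Point) ∪ ⋃ e ∈ B, G.closedEdge e

/-- A closed graph: a finite graph without boundary. -/
def IsClosedGraph : Prop := Finite V ∧ Finite E ∧ G.bdry = ∅

/-- `f ∈ C¹(𝒢)`: `f` is continuous, and on each edge interior it is differentiable with uniformly
continuous derivative. -/
def IsC1 (f : G.Point → ℝ) : Prop :=
  Continuous f ∧ ∀ e, DifferentiableOn ℝ (fun t => f (G.pt e t)) (Set.Ioo 0 (G.len e)) ∧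
    UniformContinuousOn (deriv fun t => f (G.pt e t)) (Set.Ioo 0 (G.len e))

/-- `f ∈ C¹_Dir(𝒢)`: `f ∈ C¹(𝒢)` has support of finite type and vanishes on `∂𝒢`. -/
def IsC1Dir (f : G.Point → ℝ) : Prop :=
  G.IsC1 f ∧ G.FiniteType (tsupport f) ∧ ∀ x : G.Point, x ∈ G.boundary → f x = 0

variable {G} in
/-- The gradient: on edge interiors, the derivative with respect to arc length (in the direction of
the parametrization).  It is not defined at vertices, an `ℰ`-null set; `0` is a dummy value. -/
def grad (f : G.Point → ℝ) : G.Point → ℝ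
  | .vertex _ => 0
  | .inner e t _ => deriv (fun s => f (G.pt e s)) t

variable {G} in
/-- `f` is split: `{f > 0}` and `{f < 0}` have at most half of the total `𝒱`-measure. -/
def IsSplit (f : G.Point → ℝ) : Prop :=
  G.vertexMeasure {x | 0 < f x} ≤ G.vertexMeasure Set.univ / 2 ∧
    G.vertexMeasure {x | f x < 0} ≤ G.vertexMeasure Set.univ / 2

/-- The area of a non-vertex point is the weight of its edge; vertices do not contribute. -/
def pointArea : G.Point → ℝ≥0∞
  | .vertex _ => 0
  | .inner e _ _ => ENNReal.ofReal (G.weight e)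

/-- `𝒜(∂Ω)`: the total area of the non-vertex points of `∂Ω`, and for each vertex `v ∈ ∂Ω` the sum
of the weights `a_e` of the edges `e` such that `v` is in the closure of `Ω ∩ e°`. -/
def boundaryArea (Ω : Set G.Point) : ℝ≥0∞ :=
  (∑' x : frontier Ω, G.pointArea x.1) +
    ∑' v : {v : V // (.vertex v : G.Point) ∈ frontier Ω},
      ∑' e : {e : E // (.vertex v : G.Point) ∈ closure (Ω ∩ G.edgeInterior e)}, ENNReal.ofReal (G.weight e)

/-- Admissible sets: open sets of finite type, with finite topological boundary, disjoint from
`∂𝒢`. -/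
def Admissible (Ω : Set G.Point) : Prop :=
  IsOpen Ω ∧ G.FiniteType Ω ∧ (frontier Ω).Finite ∧ Disjoint Ω G.boundary

open Classical in
/-- `i_ν(Ω) = 𝒜(∂Ω) / 𝒱(Ω)^{1/ν'}`, where `1/ν' = 1 - 1/ν`; it is `∞` if `𝒱(Ω) = 0`. -/
def isoRatio (ν : ℝ≥0∞) (Ω : Set G.Point) : ℝ≥0∞ :=
  if G.vertexMeasure Ω = 0 then ∞
  else G.boundaryArea Ω / G.vertexMeasure Ω ^ (1 - ν⁻¹.toReal)

/-- The isoperimetric constant `I_ν(𝒢)`. -/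
def isoConst (ν : ℝ≥0∞) : ℝ≥0∞ :=
  ⨅ (Ω : Set G.Point) (_ : G.Admissible Ω), G.isoRatio ν Ω

open Classical in
/-- `ĩ_ν(Ω) = 𝒜(∂Ω) min(𝒱(Ω), 𝒱(Ωᶜ))^{1/ν - 1}`; it is `∞` if the minimum is `0`. -/
def closedIsoRatio (ν : ℝ≥0∞) (Ω : Set G.Point) : ℝ≥0∞ :=
  if min (G.vertexMeasure Ω) (G.vertexMeasure Ωᶜ) = 0 then ∞
  else G.boundaryArea Ω * min (G.vertexMeasure Ω) (G.vertexMeasure Ωᶜ) ^ (ν⁻¹.toReal - 1)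

/-- The closed isoperimetric constant `Ĩ_ν(𝒢)`. -/
def closedIsoConst (ν : ℝ≥0∞) : ℝ≥0∞ :=
  ⨅ (Ω : Set G.Point) (_ : G.Admissible Ω), G.closedIsoRatio ν Ω

/-- The Nash inequality for `f` with constant `C` and dimension `ν`:
`‖∇f‖₂ ≥ C ‖f‖₂^{1 + 2/ν} ‖f‖₁^{-2/ν}`, the norms of `∇f` and `f` being taken with respect to `ℰ`
and `𝒱` respectively. -/
def NashInequality (C ν : ℝ≥0∞) (f : G.Point → ℝ) : Prop :=
  C * eLpNorm f 2 G.vertexMeasure ^ (1 + 2 * ν⁻¹.toReal) *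
      eLpNorm f 1 G.vertexMeasure ^ (-(2 * ν⁻¹.toReal)) ≤
    eLpNorm (grad f) 2 G.edgeMeasure

end MetricGraph

end

noncomputable section

namespace MetricGraph

variable {V E : Type*} (G : MetricGraph V E)

theorem pt_of_mem_Ioo (e : E) {t : ℝ} (ht : t ∈ Set.Ioo 0 (G.len e)) :
    G.pt e t = .inner e t ht := by
  simp [pt, ht.1, ht.2]

theorem pt_of_nonpos (e : E) {t : ℝ} (ht : t ≤ 0) : G.pt e t = .vertex (G.src e) := by
  simp [pt, ht, not_lt.2 ht]

theorem pt_of_len_le (e : E) {t : ℝ} (ht : G.len e ≤ t) : G.pt e t = .vertex (G.tgt e) := by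
  have := G.len_pos e
  simp [pt, not_lt.2 ht, not_le.2 (this.trans_le ht)]

theorem pt_projIcc (e : E) (t : ℝ) :
    G.pt e (Set.projIcc 0 (G.len e) (G.len_pos e).le t) = G.pt e t := by
  rcases le_total t 0 with h | h
  · rw [Set.projIcc_of_le_left _ h, G.pt_of_nonpos e h, G.pt_of_nonpos e le_rfl]
  rcases le_total (G.len e) t with h' | h'
  · rw [Set.projIcc_of_right_le _ h', G.pt_of_len_le e h', G.pt_of_len_le e le_rfl]
  · rw [Set.projIcc_of_mem _ ⟨h, h'⟩]

variable {G} in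
theorem edist_le_of_hasPath {x y : G.Point} {c : ℝ≥0∞} (h : G.HasPath x y c) : edist x y ≤ c :=
  iInf₂_le c h

theorem continuous_pt (e : E) : Continuous (G.pt e) := by
  refine LipschitzWith.continuous (K := 1) fun s t => ?_
  rw [← G.pt_projIcc e s, ← G.pt_projIcc e t]
  have h := HasPath.step (G := G) 0 e _ _ (Set.projIcc 0 (G.len e) (G.len_pos e).le s).2
    (Set.projIcc 0 (G.len e) (G.len_pos e).le t).2 .refl
  refine (edist_le_of_hasPath h).trans ?_
  rw [zero_add]
  exact LipschitzWith.projIcc (G.len_pos e).le s t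

variable {G} in
theorem measurableSet_iff {s : Set G.Point} :
    MeasurableSet s ↔ ∀ e, MeasurableSet (G.pt e ⁻¹' s) := by
  refine MeasurableSpace.measurableSet_iInf.trans (forall_congr' fun e => ?_)
  rw [BorelSpace.measurable_eq (α := ℝ)]
  exact Iff.rfl

variable {G} in
theorem measurable_of_comp_pt {β : Type*} [MeasurableSpace β] {f : G.Point → β}
    (h : ∀ e, Measurable fun t => f (G.pt e t)) : Measurable f :=
  fun _ hs => measurableSet_iff.2 fun e => h e hs

theorem measurable_pt (e : E) : Measurable (G.pt e) :=
  fun _ hs => measurableSet_iff.1 hs e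

instance : OpensMeasurableSpace G.Point :=
  ⟨MeasurableSpace.generateFrom_le fun _ hs =>
    measurableSet_iff.2 fun e => (hs.preimage (G.continuous_pt e)).measurableSet⟩

instance : MeasurableSingletonClass G.Point where
  measurableSet_singleton x := by
    refine measurableSet_iff.2 fun e => ?_
    cases x with
    | vertex v =>
      have : G.pt e ⁻¹' {.vertex v} =
          (Set.Iic 0 ∩ {_t | G.src e = v}) ∪ (Set.Ici (G.len e) ∩ {_t | G.tgt e = v}) := by
        ext t
        have := G.len_pos e
        rcases le_or_gt t 0 with h | h
        · simp [G.pt_of_nonpos e h, h, not_le.2 (h.trans_lt this)]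
        rcases le_or_gt (G.len e) t with h' | h'
        · simp [G.pt_of_len_le e h', h', not_le.2 h]
        · simp [G.pt_of_mem_Ioo e ⟨h, h'⟩, not_le.2 h, not_le.2 h']
      rw [this]
      exact (measurableSet_Iic.inter (.const _)).union (measurableSet_Ici.inter (.const _))
    | inner e' t' ht' =>
      refine Set.Subsingleton.measurableSet (s := _) ?_
      have key : ∀ t ∈ G.pt e ⁻¹' {.inner e' t' ht'}, t = t' := by
        intro t ht
        rcases le_or_gt t 0 with h | h
        · simp [G.pt_of_nonpos e h] at ht
        rcases le_or_gt (G.len e) t with h' | h'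
        · simp [G.pt_of_len_le e h'] at ht
        · rw [Set.mem_preimage, G.pt_of_mem_Ioo e ⟨h, h'⟩, Set.mem_singleton_iff] at ht
          exact (Point.inner.inj ht).2
      exact fun s hs t ht => (key s hs).trans (key t ht).symm

theorem lintegral_vertexMeasure (f : G.Point → ℝ≥0∞) :
    ∫⁻ x, f x ∂G.vertexMeasure = ∑' v, ENNReal.ofReal (G.vmass v) * f (.vertex v) := by
  simp [vertexMeasure, lintegral_sum_measure]

theorem vertexMeasure_apply {s : Set G.Point} (hs : MeasurableSet s) :
    G.vertexMeasure s = ∑' v, ENNReal.ofReal (G.vmass v) * s.indicator 1 (.vertex v) := by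
  rw [← lintegral_indicator_one hs, lintegral_vertexMeasure]

theorem lintegral_edgeMeasure {f : G.Point → ℝ≥0∞} (hf : Measurable f) :
    ∫⁻ x, f x ∂G.edgeMeasure =
      ∑' e, ENNReal.ofReal (G.weight e) * ∫⁻ t in Set.Ioo 0 (G.len e), f (G.pt e t) := by
  simp [edgeMeasure, lintegral_sum_measure, lintegral_map hf (G.measurable_pt _)]

/-- The function that is affine on every edge and takes the values `σ` at the vertices. -/
def edgeAffine (σ : V → ℝ) : G.Point → ℝ
  | .vertex v => σ v
  | .inner e t _ => σ (G.src e) + (σ (G.tgt e) - σ (G.src e)) / G.len e * t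

theorem edgeAffine_pt (σ : V → ℝ) (e : E) {t : ℝ} (ht : t ∈ Set.Icc 0 (G.len e)) :
    G.edgeAffine σ (G.pt e t) = σ (G.src e) + (σ (G.tgt e) - σ (G.src e)) / G.len e * t := by
  have := G.len_pos e
  rcases ht.1.eq_or_lt with rfl | h
  · simp [G.pt_of_nonpos e le_rfl, edgeAffine]
  rcases ht.2.eq_or_lt with rfl | h'
  · rw [G.pt_of_len_le e le_rfl]
    change σ (G.tgt e) = _
    field_simp
    ring
  · rw [G.pt_of_mem_Ioo e ⟨h, h'⟩]
    rfl

theorem lipschitzWith_edgeAffine {σ : V → ℝ} {K : NNReal} (hK0 : K ≠ 0)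
    (hK : ∀ e, |(σ (G.tgt e) - σ (G.src e)) / G.len e| ≤ K) :
    LipschitzWith K (G.edgeAffine σ) := by
  have key : ∀ {x y : G.Point} {c : ℝ≥0∞}, G.HasPath x y c →
      edist (G.edgeAffine σ x) (G.edgeAffine σ y) ≤ K * c := by
    intro x y c h
    induction h with
    | refl => simp
    | step c e s t hs ht _ ih =>
      refine (edist_triangle _ _ _).trans ((add_le_add ih ?_).trans_eq (mul_add _ _ _).symm)
      rw [G.edgeAffine_pt σ e hs, G.edgeAffine_pt σ e ht, edist_dist, edist_dist, Real.dist_eq,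
        Real.dist_eq, ← ENNReal.ofReal_coe_nnreal (p := K), ← ENNReal.ofReal_mul K.coe_nonneg]
      refine ENNReal.ofReal_le_ofReal ?_
      rw [add_sub_add_left_eq_sub, ← mul_sub, abs_mul]
      exact mul_le_mul_of_nonneg_right (hK e) (abs_nonneg _)
  intro x y
  change _ ≤ (K : ℝ≥0∞) * ⨅ (c : ℝ≥0∞) (_ : G.HasPath x y c), c
  have hK0' : (K : ℝ≥0∞) ≠ 0 := by simpa using hK0
  rw [ENNReal.mul_iInf_of_ne hK0' ENNReal.coe_ne_top]
  refine le_iInf fun c => ?_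
  rw [ENNReal.mul_iInf_of_ne hK0' ENNReal.coe_ne_top]
  exact le_iInf fun h => key h

/-- The edges with exactly one endpoint in `S`. -/
def cutEdges (S : Set V) : Set E :=
  {e | ¬(G.src e ∈ S ↔ G.tgt e ∈ S)}

open Classical in
/-- The open set that contains the vertices in `S`, the edges joining them, and the half next to
`S` of each edge with one endpoint in `S`. -/
def thickening (S : Set V) : Set G.Point :=
  {x | 0 < G.edgeAffine (fun v => if v ∈ S then 1 else -1) x}

open Classical in
theorem vertex_mem_thickening {S : Set V} {v : V} : .vertex v ∈ G.thickening S ↔ v ∈ S := by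
  by_cases h : v ∈ S <;> simp [thickening, edgeAffine, h]

open Classical in
theorem continuous_edgeAffine_sign {S : Set V} (hS : (G.cutEdges S).Finite) :
    Continuous (G.edgeAffine fun v => if v ∈ S then 1 else -1) := by
  obtain ⟨K, hK⟩ := (hS.image fun e => 2 / G.len e).bddAbove
  refine (G.lipschitzWith_edgeAffine (K := (max K 1).toNNReal) (by simp) fun e => ?_).continuous
  rw [Real.coe_toNNReal _ (by simp)]
  by_cases he : e ∈ G.cutEdges S
  · refine le_trans ?_ ((hK ⟨e, he, rfl⟩).trans (le_max_left _ _))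
    rw [abs_div, abs_of_pos (G.len_pos e)]
    refine div_le_div_of_nonneg_right ?_ (G.len_pos e).le
    split_ifs <;> norm_num
  · have : G.src e ∈ S ↔ G.tgt e ∈ S := not_not.1 he
    simp [this]

theorem isOpen_thickening {S : Set V} (hS : (G.cutEdges S).Finite) :
    IsOpen (G.thickening S) :=
  isOpen_lt continuous_const (G.continuous_edgeAffine_sign hS)

/-- The midpoint of an edge. -/
def midpoint (e : E) : G.Point :=
  G.pt e (G.len e / 2)

theorem midpoint_eq (e : E) : G.midpoint e =
    .inner e (G.len e / 2) ⟨half_pos (G.len_pos e), half_lt_self (G.len_pos e)⟩ :=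
  G.pt_of_mem_Ioo e _

theorem midpoint_injective : Function.Injective G.midpoint := by
  intro e e' h
  rw [midpoint_eq, midpoint_eq] at h
  exact (Point.inner.inj h).1

theorem frontier_thickening_subset {S : Set V} (hS : (G.cutEdges S).Finite) :
    frontier (G.thickening S) ⊆ G.midpoint '' G.cutEdges S := by
  classical
  intro x hx
  have h0 := frontier_lt_subset_eq continuous_const (G.continuous_edgeAffine_sign hS) hx
  cases x with
  | vertex v => by_cases h : v ∈ S <;> simp [edgeAffine, h] at h0
  | inner e t ht =>
    have hl := G.len_pos e
    by_cases h1 : G.src e ∈ S <;> by_cases h2 : G.tgt e ∈ S <;>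
      simp only [edgeAffine, h1, h2, if_true, if_false, Set.mem_ofPred_eq] at h0
    · norm_num at h0
    · refine ⟨e, by simp [cutEdges, h1, h2], ?_⟩
      have : t = G.len e / 2 := by field_simp at h0; linarith
      subst this
      exact G.midpoint_eq e
    · refine ⟨e, by simp [cutEdges, h1, h2], ?_⟩
      have : t = G.len e / 2 := by field_simp at h0; linarith
      subst this
      exact G.midpoint_eq e
    · norm_num at h0

theorem boundaryArea_thickening_le {S : Set V} (hS : (G.cutEdges S).Finite) :
    G.boundaryArea (G.thickening S) ≤ ∑' e : G.cutEdges S, ENNReal.ofReal (G.weight e) := by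
  have hf := G.frontier_thickening_subset hS
  have : IsEmpty {v : V // (.vertex v : G.Point) ∈ frontier (G.thickening S)} := by
    refine ⟨fun ⟨v, hv⟩ => ?_⟩
    obtain ⟨e, -, he⟩ := hf hv
    simp [midpoint_eq] at he
  rw [boundaryArea, tsum_empty (β := {v : V // _}), add_zero]
  calc _ ≤ ∑' x : G.midpoint '' G.cutEdges S, G.pointArea x := ENNReal.tsum_mono_subtype _ hf
    _ = ∑' e : G.cutEdges S, G.pointArea (G.midpoint e) :=
      tsum_image G.pointArea G.midpoint_injective.injOn
    _ = _ := by simp [midpoint_eq, pointArea]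

theorem cutEdges_subset (S : Set V) : G.cutEdges S ⊆ {e | G.src e ∈ S ∨ G.tgt e ∈ S} := by
  intro e he
  simp only [cutEdges, Set.mem_ofPred_eq] at he ⊢
  tauto

theorem finiteType_thickening {S : Set V} (hS : S.Finite)
    (hE : {e | G.src e ∈ S ∨ G.tgt e ∈ S}.Finite) : G.FiniteType (G.thickening S) := by
  refine ⟨S, _, hS, hE, fun x hx => ?_⟩
  cases x with
  | vertex v => exact .inl ⟨v, G.vertex_mem_thickening.1 hx, rfl⟩
  | inner e t ht =>
    refine .inr (Set.mem_iUnion₂.2 ⟨e, ?_, t, Set.Ioo_subset_Icc_self ht, G.pt_of_mem_Ioo e ht⟩)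
    by_contra h
    simp only [Set.mem_ofPred_eq, not_or] at h
    simp [thickening, edgeAffine, h.1, h.2] at hx
    linarith

theorem admissible_thickening {S : Set V} (hS : S.Finite)
    (hE : {e | G.src e ∈ S ∨ G.tgt e ∈ S}.Finite) (hb : Disjoint S G.bdry) :
    G.Admissible (G.thickening S) := by
  have hc := hE.subset (G.cutEdges_subset S)
  refine ⟨G.isOpen_thickening hc, G.finiteType_thickening hS hE,
    (hc.image _).subset (G.frontier_thickening_subset hc), Set.disjoint_left.2 ?_⟩
  rintro _ hx ⟨v, hv, rfl⟩
  exact Set.disjoint_left.1 hb (G.vertex_mem_thickening.1 hx) hv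

theorem vertexMeasure_thickening {S : Set V} (hS : (G.cutEdges S).Finite) :
    G.vertexMeasure (G.thickening S) = ∑' v : S, ENNReal.ofReal (G.vmass v) := by
  rw [G.vertexMeasure_apply (G.isOpen_thickening hS).measurableSet, tsum_subtype S
    fun v => ENNReal.ofReal (G.vmass v)]
  refine tsum_congr fun v => ?_
  by_cases h : v ∈ S <;> simp [vertex_mem_thickening, h]

/-- Finitely many vertices carry a function whose support is of finite type. -/
theorem finite_vertex_support {f : G.Point → ℝ} (hf : G.FiniteType (tsupport f)) :
    {v | f (.vertex v) ≠ 0}.Finite := by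
  obtain ⟨A, B, hA, hB, hAB⟩ := hf
  refine ((hA.union (hB.image G.src)).union (hB.image G.tgt)).subset fun v hv => ?_
  rcases hAB (subset_tsupport f hv) with ⟨w, hw, h⟩ | h
  · exact .inl (.inl (Point.vertex.inj h ▸ hw))
  · obtain ⟨e, he, t, ht, h⟩ := Set.mem_iUnion₂.1 h
    rcases le_or_gt t 0 with h1 | h1
    · rw [G.pt_of_nonpos e h1] at h
      exact .inl (.inr ⟨e, he, Point.vertex.inj h⟩)
    rcases le_or_gt (G.len e) t with h2 | h2
    · rw [G.pt_of_len_le e h2] at h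
      exact .inr ⟨e, he, Point.vertex.inj h⟩
    · rw [G.pt_of_mem_Ioo e ⟨h1, h2⟩] at h
      cases h

/-- Finitely many edges meet the vertices at which a continuous function with support of finite type
does not vanish. -/
theorem finite_edge_support {f : G.Point → ℝ} (hc : Continuous f)
    (hf : G.FiniteType (tsupport f)) :
    {e | f (.vertex (G.src e)) ≠ 0 ∨ f (.vertex (G.tgt e)) ≠ 0}.Finite := by
  obtain ⟨A, B, hA, hB, hAB⟩ := hf
  refine hB.subset fun e he => ?_
  have hl := G.len_pos e
  have hmem : ∃ t ∈ Set.Ioo 0 (G.len e), f (G.pt e t) ≠ 0 := by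
    by_contra! h
    have hcl : ∀ t ∈ Set.Icc 0 (G.len e), f (G.pt e t) = 0 := by
      rw [← closure_Ioo hl.ne]
      exact fun t ht => closure_minimal (t := {t | f (G.pt e t) = 0}) h
        (isClosed_eq (hc.comp (G.continuous_pt e)) continuous_const) ht
    have h0 := hcl 0 ⟨le_rfl, hl.le⟩
    have h1 := hcl _ ⟨hl.le, le_rfl⟩
    rw [G.pt_of_nonpos e le_rfl] at h0
    rw [G.pt_of_len_le e le_rfl] at h1
    exact he.elim (· h0) (· h1)
  obtain ⟨t, ht, hne⟩ := hmem
  have := hAB (subset_tsupport f hne)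
  rw [G.pt_of_mem_Ioo e ht] at this
  rcases this with ⟨w, hw, h⟩ | h
  · cases h
  · obtain ⟨e', he', t', ht', h⟩ := Set.mem_iUnion₂.1 h
    rcases le_or_gt t' 0 with h1 | h1
    · rw [G.pt_of_nonpos e' h1] at h
      cases h
    rcases le_or_gt (G.len e') t' with h2 | h2
    · rw [G.pt_of_len_le e' h2] at h
      cases h
    · rw [G.pt_of_mem_Ioo e' ⟨h1, h2⟩] at h
      exact (Point.inner.inj h).1 ▸ he'

end MetricGraph

theorem ENNReal.weighted_Lp_add_le {ι : Type*} (s : Finset ι) (μ f g : ι → ℝ≥0∞) {p : ℝ}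
    (hp : 1 ≤ p) :
    (∑ i ∈ s, μ i * (f i + g i) ^ p) ^ (1 / p) ≤
      (∑ i ∈ s, μ i * f i ^ p) ^ (1 / p) + (∑ i ∈ s, μ i * g i ^ p) ^ (1 / p) := by
  have hp0 : 0 < p := zero_lt_one.trans_le hp
  have key : ∀ (x y : ℝ≥0∞), (x ^ p⁻¹ * y) ^ p = x * y ^ p := fun x y => by
    rw [ENNReal.mul_rpow_of_nonneg _ _ hp0.le, ENNReal.rpow_inv_rpow hp0.ne']
  have h := ENNReal.Lp_add_le s (fun i => μ i ^ p⁻¹ * f i) (fun i => μ i ^ p⁻¹ * g i) hp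
  simpa only [← mul_add, key] using h

theorem ENNReal.tsum_mul_le_sqrt_mul_sqrt {ι : Type*} (f g : ι → ℝ≥0∞) :
    ∑' i, f i * g i ≤ (∑' i, f i ^ (2 : ℝ)) ^ (1 / 2 : ℝ) * (∑' i, g i ^ (2 : ℝ)) ^ (1 / 2 : ℝ) := by
  rw [ENNReal.tsum_eq_iSup_sum]
  refine iSup_le fun s =>
    (ENNReal.inner_le_Lp_mul_Lq s f g Real.HolderConjugate.two_two).trans ?_
  gcongr <;> exact ENNReal.sum_le_tsum s

/-- The interpolation inequality between the `L¹`, `L²` and `L^{2p}` norms, `1 / p = 1 - a`. -/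
theorem ENNReal.sum_sq_rpow_le {ι : Type*} (s : Finset ι) (μ f : ι → ℝ≥0∞) {a : ℝ} (ha0 : 0 ≤ a)
    (ha1 : a < 1) :
    (∑ i ∈ s, μ i * f i ^ (2 : ℝ)) ^ (1 + a) ≤
      (∑ i ∈ s, μ i * f i) ^ (2 * a) *
        (∑ i ∈ s, μ i * (f i ^ (2 : ℝ)) ^ (1 - a)⁻¹) ^ (1 - a) := by
  have h1 : 0 < 1 - a := by linarith
  have hr : 1 ≤ (1 + a) / (1 - a) := by rw [le_div_iff₀ h1]; linarith
  have h := ENNReal.inner_le_weight_mul_Lp_of_nonneg s hr (fun i => μ i * f i) f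
  have e1 : ∀ i, μ i * f i * f i = μ i * f i ^ (2 : ℝ) := fun i => by
    rw [mul_assoc, ENNReal.rpow_two, sq]
  have e2 : ∀ i, μ i * f i * f i ^ ((1 + a) / (1 - a)) = μ i * (f i ^ (2 : ℝ)) ^ (1 - a)⁻¹ := by
    intro i
    have : f i ^ (1 + (1 + a) / (1 - a)) = f i * f i ^ ((1 + a) / (1 - a)) := by
      rw [ENNReal.rpow_add_of_nonneg _ _ zero_le_one (by positivity), ENNReal.rpow_one]
    rw [mul_assoc, ← this, ← ENNReal.rpow_mul]
    congr 2
    field_simp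
    ring
  simp only [e1, e2] at h
  refine (ENNReal.rpow_le_rpow h (by linarith : 0 ≤ 1 + a)).trans_eq ?_
  rw [ENNReal.mul_rpow_of_nonneg _ _ (by linarith), ← ENNReal.rpow_mul, ← ENNReal.rpow_mul]
  have h2 : 1 + a ≠ 0 := by linarith
  congr 2 <;> field_simp
  ring

theorem abs_posPart_sq_sub_add_abs_negPart_sq_sub_le (x y : ℝ) :
    |x⁺ ^ 2 - y⁺ ^ 2| + |x⁻ ^ 2 - y⁻ ^ 2| ≤ |x - y| * (|x| + |y|) := by
  have h1 : |x⁺ - y⁺| + |x⁻ - y⁻| ≤ |x - y| := by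
    simp only [posPart_def, negPart_def]
    rcases le_total 0 x with hx | hx <;> rcases le_total 0 y with hy | hy <;>
      simp only [sup_of_le_left, sup_of_le_right, hx, hy, Left.neg_nonpos_iff,
        Left.nonneg_neg_iff] <;> rcases abs_cases (x - y) with h | h <;>
      simp only [h, abs_of_nonneg, abs_of_nonpos, sub_zero, zero_sub, hx, hy, abs_neg,
        sub_self, le_refl, add_zero, zero_add] <;>
      first | linarith | (rw [← h.1, ← abs_neg]; ring_nf; rfl)
  have key : ∀ u v : ℝ, 0 ≤ u → 0 ≤ v → u ≤ |x| → v ≤ |y| →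
      |u ^ 2 - v ^ 2| ≤ |u - v| * (|x| + |y|) := by
    intro u v hu hv hux hvy
    rw [sq_sub_sq, abs_mul, mul_comm, abs_of_nonneg (add_nonneg hu hv)]
    gcongr
  have hx := posPart_add_negPart x
  have hy := posPart_add_negPart y
  have := key _ _ (posPart_nonneg x) (posPart_nonneg y)
    (by linarith [negPart_nonneg x]) (by linarith [negPart_nonneg y])
  have := key _ _ (negPart_nonneg x) (negPart_nonneg y)
    (by linarith [posPart_nonneg x]) (by linarith [posPart_nonneg y])
  have := mul_le_mul_of_nonneg_right h1 (add_nonneg (abs_nonneg x) (abs_nonneg y))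
  linarith

namespace MetricGraph

variable {V E : Type*} (G : MetricGraph V E)

/-- The total weight of the edges with exactly one endpoint in `S`. -/
def cutWeight (S : Set V) : ℝ≥0∞ :=
  ∑' e : G.cutEdges S, ENNReal.ofReal (G.weight e)

/-- The weighted total variation `∑_e a_e |g(y) - g(x)|` of a function on the vertices, where `e`
joins `x` to `y`. -/
def totalVariation (g : V → ℝ) : ℝ≥0∞ :=
  ∑' e, ENNReal.ofReal (G.weight e) * ENNReal.ofReal |g (G.tgt e) - g (G.src e)|

theorem totalVariation_eq_layer {g : V → ℝ} {S : Set V} {c : ℝ} (hc : 0 ≤ c)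
    (hS : ∀ v ∈ S, c ≤ g v) (hS' : ∀ v ∉ S, g v = 0) :
    G.totalVariation g =
      ENNReal.ofReal c * G.cutWeight S + G.totalVariation (fun v => max (g v - c) 0) := by
  classical
  rw [cutWeight, tsum_subtype (G.cutEdges S) fun e => ENNReal.ofReal (G.weight e),
    ← ENNReal.tsum_mul_left, totalVariation, totalVariation, ← ENNReal.tsum_add]
  refine tsum_congr fun e => ?_
  by_cases h1 : G.src e ∈ S <;> by_cases h2 : G.tgt e ∈ S
  · have : e ∉ G.cutEdges S := by simp [cutEdges, h1, h2]
    simp [this, hS _ h1, hS _ h2]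
  · have : e ∈ G.cutEdges S := by simp [cutEdges, h1, h2]
    have h := hS _ h1
    rw [Set.indicator_of_mem this, mul_comm (ENNReal.ofReal c), ← mul_add, hS' _ h2,
      ← ENNReal.ofReal_add hc (abs_nonneg _), max_eq_left (sub_nonneg.2 h),
      max_eq_right (by linarith), zero_sub, zero_sub, abs_neg, abs_neg,
      abs_of_nonneg (hc.trans h), abs_of_nonneg (sub_nonneg.2 h), add_sub_cancel]
  · have : e ∈ G.cutEdges S := by simp [cutEdges, h1, h2]
    have h := hS _ h2
    rw [Set.indicator_of_mem this, mul_comm (ENNReal.ofReal c), ← mul_add, hS' _ h1,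
      ← ENNReal.ofReal_add hc (abs_nonneg _), max_eq_left (sub_nonneg.2 h),
      max_eq_right (by linarith), sub_zero, sub_zero,
      abs_of_nonneg (hc.trans h), abs_of_nonneg (sub_nonneg.2 h), add_sub_cancel]
  · have : e ∉ G.cutEdges S := by simp [cutEdges, h1, h2]
    simp [this, hS' _ h1, hS' _ h2]

/-- A discrete Federer–Fleming theorem: an isoperimetric inequality for the subsets of the support
of `g` gives a Sobolev inequality for `g`. -/
theorem mul_Lp_le_totalVariation {J : ℝ≥0∞} {p : ℝ} (hp : 1 ≤ p) (W : Finset V) (g : V → ℝ)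
    (hg : ∀ v, 0 ≤ g v) (hW : ∀ v, g v ≠ 0 → v ∈ W)
    (hJ : ∀ S : Finset V, (∀ v ∈ S, g v ≠ 0) →
      J * (∑ v ∈ S, ENNReal.ofReal (G.vmass v)) ^ (1 / p) ≤ G.cutWeight S) :
    J * (∑ v ∈ W, ENNReal.ofReal (G.vmass v) * ENNReal.ofReal (g v) ^ p) ^ (1 / p) ≤
      G.totalVariation g := by
  classical
  have hp0 : 0 < p := zero_lt_one.trans_le hp
  induction hn : (W.filter fun v => g v ≠ 0).card using Nat.strong_induction_on generalizing g with
  | _ n ih =>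
  rcases (W.filter fun v => g v ≠ 0).eq_empty_or_nonempty with hS | hS
  · have : ∀ v ∈ W, g v = 0 := fun v hv => by
      by_contra h
      exact Finset.notMem_empty v (hS ▸ Finset.mem_filter.2 ⟨hv, h⟩)
    rw [Finset.sum_eq_zero fun v hv => by simp [this v hv, hp0]]
    simp [hp0]
  set S := W.filter fun v => g v ≠ 0 with hSdef
  have hmem : ∀ v, v ∈ S ↔ g v ≠ 0 := fun v =>
    ⟨fun h => (Finset.mem_filter.1 h).2, fun h => Finset.mem_filter.2 ⟨hW v h, h⟩⟩
  obtain ⟨w, hw, hmin⟩ := S.exists_min_image g hS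
  have hc := hg w
  set c := g w with hcdef
  set g' : V → ℝ := fun v => max (g v - c) 0 with hg'
  have hsub : ∀ v, g' v ≠ 0 → g v ≠ 0 := by
    intro v h h0
    simp [hg', h0, hc] at h
  have hind := ih _ (hn ▸ Finset.card_lt_card (s := W.filter fun v => g' v ≠ 0)
    (Finset.ssubset_iff_subset_ne.2 ⟨fun v hv => by
      rw [hmem]
      exact hsub v (Finset.mem_filter.1 hv).2, fun h => by
      rw [← h] at hw
      simp [hg', ← hcdef] at hw⟩)) g' (fun v => le_max_right _ _) (fun v h => hW v (hsub v h))
    (fun T hT => hJ T fun v hv => hsub v (hT v hv)) rfl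
  rw [G.totalVariation_eq_layer (S := S) hc hmin fun v hv => by simpa [hmem] using hv]
  have hdec : ∀ v, ENNReal.ofReal (g v) =
      (if v ∈ S then ENNReal.ofReal c else 0) + ENNReal.ofReal (g' v) := by
    intro v
    split_ifs with h
    · rw [← ENNReal.ofReal_add hc (le_max_right _ _), max_eq_left (sub_nonneg.2 (hmin v h)),
        add_sub_cancel]
    · have h0 : g v = 0 := by simpa [hmem] using h
      simp [hg', h0, hc]
  have hmink := ENNReal.weighted_Lp_add_le W (fun v => ENNReal.ofReal (G.vmass v))
    (fun v => if v ∈ S then ENNReal.ofReal c else 0) (fun v => ENNReal.ofReal (g' v)) hp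
  have hone : (∑ v ∈ W, ENNReal.ofReal (G.vmass v) * (if v ∈ S then ENNReal.ofReal c else 0) ^ p)
      ^ (1 / p) = ENNReal.ofReal c * (∑ v ∈ S, ENNReal.ofReal (G.vmass v)) ^ (1 / p) := by
    have : ∑ v ∈ W, ENNReal.ofReal (G.vmass v) * (if v ∈ S then ENNReal.ofReal c else 0) ^ p =
        ENNReal.ofReal c ^ p * ∑ v ∈ S, ENNReal.ofReal (G.vmass v) := by
      rw [Finset.mul_sum, ← Finset.sum_subset (Finset.filter_subset (fun v => g v ≠ 0) W)]
      · refine Finset.sum_congr rfl fun v hv => ?_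
        rw [if_pos hv, mul_comm]
      · intro v _ hv
        rw [if_neg hv, ENNReal.zero_rpow_of_pos hp0, mul_zero]
    rw [this, ENNReal.mul_rpow_of_nonneg _ _ (by positivity), one_div,
      ENNReal.rpow_rpow_inv hp0.ne']
  rw [hone] at hmink
  simp only [hdec]
  refine (mul_le_mul_right hmink J).trans ?_
  rw [mul_add, mul_left_comm]
  exact add_le_add (mul_le_mul_right (hJ S fun v hv => (hmem v).1 hv) _) hind

/-- The increment along an edge is controlled by the gradient on that edge. -/
theorem ofReal_abs_sub_sq_le {f : G.Point → ℝ} (hf : G.IsC1 f) (e : E) :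
    ENNReal.ofReal |f (.vertex (G.tgt e)) - f (.vertex (G.src e))| ^ (2 : ℝ) ≤
      ENNReal.ofReal (G.len e) *
        ∫⁻ t in Set.Ioo 0 (G.len e), ‖grad f (G.pt e t)‖ₑ ^ (2 : ℝ) := by
  have hl := (G.len_pos e).le
  set h : ℝ → ℝ := fun t => f (G.pt e t) with hh
  have hgrad : ∫⁻ t in Set.Ioo 0 (G.len e), ‖grad f (G.pt e t)‖ₑ ^ (2 : ℝ) =
      ∫⁻ t in Set.Ioo 0 (G.len e), ‖deriv h t‖ₑ ^ (2 : ℝ) :=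
    setLIntegral_congr_fun measurableSet_Ioo fun t ht => by
      simp only [G.pt_of_mem_Ioo e ht]
      rfl
  have hcont : ContinuousOn h (Set.Icc 0 (G.len e)) :=
    (hf.1.comp (G.continuous_pt e)).continuousOn
  have h1 : ENNReal.ofReal |f (.vertex (G.tgt e)) - f (.vertex (G.src e))| ≤
      ∫⁻ t in Set.Ioo 0 (G.len e), ‖deriv h t‖ₑ := by
    by_cases htop : ∫⁻ t in Set.Ioo 0 (G.len e), ‖deriv h t‖ₑ = ∞
    · rw [htop]
      exact le_top
    have hint : IntegrableOn (deriv h) (Set.Ioo 0 (G.len e)) :=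
      ⟨(measurable_deriv h).aestronglyMeasurable, lt_top_iff_ne_top.2 htop⟩
    have hftc := intervalIntegral.integral_eq_sub_of_hasDerivAt_of_le hl hcont
      (fun t ht => (((hf.2 e).1 t ht).differentiableAt (isOpen_Ioo.mem_nhds ht)).hasDerivAt)
      ((intervalIntegrable_iff_integrableOn_Ioo_of_le hl).2 hint)
    rw [hh] at hftc
    simp only [G.pt_of_nonpos e le_rfl, G.pt_of_len_le e le_rfl] at hftc
    rw [← hftc, intervalIntegral.integral_of_le hl, integral_Ioc_eq_integral_Ioo, ← Real.norm_eq_abs,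
      ofReal_norm]
    exact enorm_integral_le_lintegral_enorm _
  have h2 := ENNReal.lintegral_mul_le_Lp_mul_Lq (volume.restrict (Set.Ioo 0 (G.len e)))
    Real.HolderConjugate.two_two (f := 1) (g := fun t => ‖deriv h t‖ₑ) aemeasurable_const
    (measurable_deriv h).enorm.aemeasurable
  simp only [one_mul, Pi.one_apply, ENNReal.one_rpow, lintegral_one, Measure.restrict_apply_univ,
    Real.volume_Ioo, sub_zero] at h2
  rw [hgrad]
  refine (ENNReal.rpow_le_rpow (h1.trans h2) zero_le_two).trans_eq ?_
  rw [ENNReal.mul_rpow_of_nonneg _ _ zero_le_two, ← ENNReal.rpow_mul, ← ENNReal.rpow_mul]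
  norm_num

theorem measurable_grad (f : G.Point → ℝ) : Measurable (grad f) := by
  classical
  refine measurable_of_comp_pt fun e => ?_
  have : (fun t => grad f (G.pt e t)) =
      (Set.Ioo 0 (G.len e)).indicator (deriv fun t => f (G.pt e t)) := by
    ext t
    by_cases ht : t ∈ Set.Ioo 0 (G.len e)
    · rw [Set.indicator_of_mem ht, G.pt_of_mem_Ioo e ht]
      rfl
    · rw [Set.indicator_of_notMem ht, pt, dif_neg ht]
      split_ifs <;> rfl
  rw [this]
  exact (measurable_deriv _).indicator measurableSet_Ioo

theorem tsum_incident_le (v : V) :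
    ∑' e : {e : E // G.src e = v ∨ G.tgt e = v}, ENNReal.ofReal (G.weight e * G.len e) ≤
      2 * G.rhoSup * ENNReal.ofReal (G.vmass v) := by
  have h : G.halfDegree v ≤ G.rhoSup := le_iSup G.halfDegree v
  have h0 : ENNReal.ofReal (G.vmass v) ≠ 0 := by simpa using G.vmass_pos v
  simp only [halfDegree, div_eq_mul_inv, ENNReal.tsum_mul_right] at h
  rw [← ENNReal.div_eq_inv_mul, ENNReal.div_le_iff h0 ENNReal.ofReal_ne_top, ← div_eq_mul_inv,
    ENNReal.div_le_iff two_ne_zero ENNReal.ofNat_ne_top] at h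
  rwa [mul_assoc, mul_comm]

/-- Loops excluded, the energy of `|f|` on the edges is at most `4 ρ_sup` times that on the
vertices. -/
theorem tsum_edge_energy_le (φ : V → ℝ≥0∞) :
    ∑' e : {e : E // G.src e ≠ G.tgt e}, ENNReal.ofReal (G.weight e * G.len e) *
        (φ (G.src e) + φ (G.tgt e)) ^ (2 : ℝ) ≤
      4 * G.rhoSup * ∑' v, ENNReal.ofReal (G.vmass v) * φ v ^ (2 : ℝ) := by
  classical
  set c : E → ℝ≥0∞ := fun e => ENNReal.ofReal (G.weight e * G.len e)
  have hsq : ∀ x y : ℝ≥0∞, (x + y) ^ (2 : ℝ) ≤ 2 * (x ^ (2 : ℝ) + y ^ (2 : ℝ)) := by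
    intro x y
    have := ENNReal.rpow_add_le_mul_rpow_add_rpow x y one_le_two
    norm_num at this ⊢
    exact this
  calc _ ≤ ∑' e : {e : E // G.src e ≠ G.tgt e}, ∑' v,
        2 * (c e * (if G.src e = v ∨ G.tgt e = v then φ v ^ (2 : ℝ) else 0)) := by
        refine ENNReal.tsum_le_tsum fun e => ?_
        refine (mul_le_mul_right (hsq _ _) _).trans ?_
        rw [ENNReal.tsum_mul_left, ENNReal.tsum_mul_left, mul_left_comm]
        gcongr
        refine le_trans ?_ (ENNReal.sum_le_tsum {G.src e, G.tgt e})
        rw [Finset.sum_pair e.2]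
        simp
    _ = ∑' v, ∑' e : {e : E // G.src e ≠ G.tgt e},
        2 * (c e * (if G.src e = v ∨ G.tgt e = v then φ v ^ (2 : ℝ) else 0)) :=
        ENNReal.tsum_comm
    _ ≤ ∑' v, ∑' e : E,
        2 * (c e * (if G.src e = v ∨ G.tgt e = v then φ v ^ (2 : ℝ) else 0)) :=
        ENNReal.tsum_le_tsum fun v => ENNReal.tsum_comp_le_tsum_of_injective
          Subtype.val_injective _
    _ = ∑' v, 2 * φ v ^ (2 : ℝ) * ∑' e : {e : E // G.src e = v ∨ G.tgt e = v}, c e := by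
        refine tsum_congr fun v => ?_
        refine Eq.trans ?_ (congrArg _ (tsum_subtype {e : E | G.src e = v ∨ G.tgt e = v} c).symm)
        rw [← ENNReal.tsum_mul_left]
        refine tsum_congr fun e => ?_
        by_cases h : G.src e = v ∨ G.tgt e = v
        · rw [if_pos h, Set.indicator_of_mem (s := {e : E | G.src e = v ∨ G.tgt e = v}) h]
          ring
        · rw [if_neg h, Set.indicator_of_notMem (s := {e : E | G.src e = v ∨ G.tgt e = v}) h]
          simp
    _ ≤ ∑' v, 2 * φ v ^ (2 : ℝ) * (2 * G.rhoSup * ENNReal.ofReal (G.vmass v)) := by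
        gcongr with v
        exact G.tsum_incident_le v
    _ = _ := by
        rw [← ENNReal.tsum_mul_left]
        exact tsum_congr fun v => by ring

/-- Cauchy–Schwarz on the edges that are not loops. -/
theorem tsum_increment_mul_le {f : G.Point → ℝ} (hf : G.IsC1 f) :
    ∑' e, ENNReal.ofReal (G.weight e) *
        (ENNReal.ofReal |f (.vertex (G.tgt e)) - f (.vertex (G.src e))| *
          (‖f (.vertex (G.src e))‖ₑ + ‖f (.vertex (G.tgt e))‖ₑ)) ≤
      eLpNorm (grad f) 2 G.edgeMeasure *
        (2 * G.rhoSup ^ (1 / 2 : ℝ) * eLpNorm f 2 G.vertexMeasure) := by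
  classical
  set φ : V → ℝ≥0∞ := fun v => ‖f (.vertex v)‖ₑ
  set D : E → ℝ≥0∞ := fun e => ∫⁻ t in Set.Ioo 0 (G.len e), ‖grad f (G.pt e t)‖ₑ ^ (2 : ℝ)
  have hterm : ∀ e, ENNReal.ofReal |f (.vertex (G.tgt e)) - f (.vertex (G.src e))| ≤
      (ENNReal.ofReal (G.len e) * D e) ^ (1 / 2 : ℝ) := fun e => by
    rw [one_div, ENNReal.le_rpow_inv_iff two_pos]
    exact G.ofReal_abs_sub_sq_le hf e
  have hsum : ∑' e, ENNReal.ofReal (G.weight e) *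
        (ENNReal.ofReal |f (.vertex (G.tgt e)) - f (.vertex (G.src e))| *
          (φ (G.src e) + φ (G.tgt e))) ≤
      ∑' e : {e : E // G.src e ≠ G.tgt e}, (ENNReal.ofReal (G.weight e) * D e) ^ (1 / 2 : ℝ) *
        (ENNReal.ofReal (G.weight e * G.len e) ^ (1 / 2 : ℝ) *
          (φ (G.src e) + φ (G.tgt e))) := by
    refine le_of_le_of_eq ?_ (tsum_subtype {e : E | G.src e ≠ G.tgt e} fun e =>
      (ENNReal.ofReal (G.weight e) * D e) ^ (1 / 2 : ℝ) *
        (ENNReal.ofReal (G.weight e * G.len e) ^ (1 / 2 : ℝ) *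
          (φ (G.src e) + φ (G.tgt e)))).symm
    refine ENNReal.tsum_le_tsum fun e => ?_
    by_cases h : G.src e = G.tgt e
    · simp [h]
    rw [Set.indicator_of_mem (s := {e : E | G.src e ≠ G.tgt e}) h, ← mul_assoc, ← mul_assoc]
    refine mul_le_mul_left ((mul_le_mul_right (hterm e) _).trans_eq ?_) _
    have hh : (0 : ℝ) ≤ 1 / 2 := by norm_num
    rw [ENNReal.ofReal_mul (G.weight_pos e).le, ENNReal.mul_rpow_of_nonneg _ _ hh,
      ENNReal.mul_rpow_of_nonneg _ _ hh, ENNReal.mul_rpow_of_nonneg _ _ hh]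
    have : ENNReal.ofReal (G.weight e) =
        ENNReal.ofReal (G.weight e) ^ (1 / 2 : ℝ) * ENNReal.ofReal (G.weight e) ^ (1 / 2 : ℝ) := by
      rw [← ENNReal.rpow_add_of_nonneg _ _ hh hh]
      norm_num
    conv_lhs => rw [this]
    ring
  have hsq : ∀ x : ℝ≥0∞, (x ^ (1 / 2 : ℝ)) ^ (2 : ℝ) = x := fun x => by
    rw [one_div, ENNReal.rpow_inv_rpow two_ne_zero]
  refine hsum.trans ((ENNReal.tsum_mul_le_sqrt_mul_sqrt _ _).trans ?_)
  rw [eLpNorm_eq_lintegral_rpow_enorm_toReal two_ne_zero ENNReal.ofNat_ne_top,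
    eLpNorm_eq_lintegral_rpow_enorm_toReal two_ne_zero ENNReal.ofNat_ne_top, ENNReal.toReal_ofNat,
    lintegral_vertexMeasure, lintegral_edgeMeasure _ ((measurable_grad G f).enorm.pow_const _)]
  simp only [ENNReal.mul_rpow_of_nonneg _ _ zero_le_two, hsq]
  refine mul_le_mul' ?_ ?_
  · gcongr
    exact ENNReal.tsum_comp_le_tsum_of_injective Subtype.val_injective
      fun e => ENNReal.ofReal (G.weight e) * D e
  · refine (ENNReal.rpow_le_rpow (G.tsum_edge_energy_le φ) (by norm_num)).trans_eq ?_
    rw [ENNReal.mul_rpow_of_nonneg _ _ (by norm_num), ENNReal.mul_rpow_of_nonneg _ _ (by norm_num)]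
    congr 2
    rw [one_div, show (4 : ℝ≥0∞) = 2 ^ (2 : ℝ) by norm_num, ENNReal.rpow_rpow_inv two_ne_zero]

end MetricGraph

theorem ENNReal.mul_rpow_neg_half_div_two_mul_le {J ρ K D : ℝ≥0∞} (hK : K ≠ 0)
    (h : J * K ≤ D * (2 * ρ ^ (1 / 2 : ℝ))) : J * ρ ^ (-(1 / 2) : ℝ) / 2 * K ≤ D := by
  rcases eq_or_ne ρ 0 with rfl | h0
  · have : J = 0 := by simpa [hK] using h
    simp [this]
  rcases eq_or_ne ρ ∞ with rfl | htop
  · simp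
  calc J * ρ ^ (-(1 / 2) : ℝ) / 2 * K = J * K * (ρ ^ (-(1 / 2) : ℝ) * 2⁻¹) := by
        rw [div_eq_mul_inv]; ring
    _ ≤ D * (2 * ρ ^ (1 / 2 : ℝ)) * (ρ ^ (-(1 / 2) : ℝ) * 2⁻¹) := by gcongr
    _ = D * ((ρ ^ (1 / 2 : ℝ) * ρ ^ (-(1 / 2) : ℝ)) * (2 * 2⁻¹)) := by ring
    _ = D := by
        rw [← ENNReal.rpow_add _ _ h0 htop, ENNReal.mul_inv_cancel two_ne_zero ENNReal.ofNat_ne_top]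
        simp

theorem ENNReal.toReal_inv_lt_one {ν : ℝ≥0∞} (hν : 1 < ν) : ν⁻¹.toReal < 1 := by
  have h : ν⁻¹ < 1 := ENNReal.inv_lt_one.2 hν
  simpa using (ENNReal.toReal_lt_toReal h.ne_top ENNReal.one_ne_top).2 h

/-- A weighted median. -/
theorem exists_weighted_median {ι : Type*} [Fintype ι] {m : ι → ℝ} (hm : ∀ i, 0 < m i)
    (φ : ι → ℝ) :
    ∃ c : ℝ, ∑ i with c < φ i, m i ≤ (∑ i, m i) / 2 ∧ ∑ i with φ i < c, m i ≤ (∑ i, m i) / 2 := by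
  classical
  have hM : 0 ≤ ∑ i, m i := Finset.sum_nonneg fun i _ => (hm i).le
  rcases isEmpty_or_nonempty ι with hι | hι
  · exact ⟨0, by simp⟩
  set A := Finset.univ.filter fun i => ∑ j with φ i < φ j, m j ≤ (∑ j, m j) / 2 with hA
  have hAne : A.Nonempty := by
    obtain ⟨i, hi⟩ := Finite.exists_max φ
    refine ⟨i, Finset.mem_filter.2 ⟨Finset.mem_univ _, ?_⟩⟩
    rw [Finset.filter_eq_empty_iff.2 fun j _ => not_lt.2 (hi j), Finset.sum_empty]
    positivity
  obtain ⟨i, hi, hmin⟩ := A.exists_min_image φ hAne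
  refine ⟨φ i, (Finset.mem_filter.1 hi).2, ?_⟩
  rcases (Finset.univ.filter fun j => φ j < φ i).eq_empty_or_nonempty with h0 | hne
  · rw [h0, Finset.sum_empty]
    positivity
  obtain ⟨k, hk, hmax⟩ := Finset.exists_max_image _ φ hne
  have hki : φ k < φ i := (Finset.mem_filter.1 hk).2
  have hkA : ¬ ∑ j with φ k < φ j, m j ≤ (∑ j, m j) / 2 := fun h =>
    absurd (hmin k (Finset.mem_filter.2 ⟨Finset.mem_univ _, h⟩)) (not_le.2 hki)
  have hcompl : (Finset.univ.filter fun j => φ k < φ j) =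
      Finset.univ.filter fun j => ¬ φ j < φ i := by
    refine Finset.filter_congr fun j _ => ⟨fun h h' => ?_, fun h => hki.trans_le (not_lt.1 h)⟩
    exact absurd (hmax j (Finset.mem_filter.2 ⟨Finset.mem_univ _, h'⟩)) (not_le.2 h)
  rw [hcompl] at hkA
  have := Finset.sum_filter_add_sum_filter_not Finset.univ (fun j => φ j < φ i) m
  linarith

theorem sum_mul_abs_sub_median_le {ι : Type*} [Fintype ι] {m : ι → ℝ} (hm : ∀ i, 0 < m i)
    (φ : ι → ℝ) {c : ℝ} (h1 : ∑ i with c < φ i, m i ≤ (∑ i, m i) / 2)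
    (h2 : ∑ i with φ i < c, m i ≤ (∑ i, m i) / 2) :
    ∑ i, m i * |φ i - c| ≤ ∑ i, m i * |φ i| := by
  have key : ∀ (P : ι → Prop) [DecidablePred P], ∑ i with P i, m i ≤ (∑ i, m i) / 2 →
      (∀ i, |φ i - c| ≤ |φ i| + |c| * (if P i then 1 else -1)) →
      ∑ i, m i * |φ i - c| ≤ ∑ i, m i * |φ i| := by
    intro P _ hP h
    have hsum : ∑ i, m i * (if P i then 1 else -1) ≤ 0 := by
      have e : ∀ i, m i * (if P i then (1 : ℝ) else -1) = 2 * (if P i then m i else 0) - m i := by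
        intro i
        split_ifs <;> ring
      simp only [e, Finset.sum_sub_distrib, ← Finset.mul_sum, ← Finset.sum_filter]
      linarith
    calc ∑ i, m i * |φ i - c| ≤ ∑ i, m i * (|φ i| + |c| * (if P i then 1 else -1)) :=
          Finset.sum_le_sum fun i _ => mul_le_mul_of_nonneg_left (h i) (hm i).le
      _ = ∑ i, m i * |φ i| + |c| * ∑ i, m i * (if P i then 1 else -1) := by
          rw [Finset.mul_sum, ← Finset.sum_add_distrib]
          exact Finset.sum_congr rfl fun i _ => by ring
      _ ≤ _ := by
          have := mul_nonpos_of_nonneg_of_nonpos (abs_nonneg c) hsum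
          linarith
  rcases le_total 0 c with hc | hc
  · refine key (fun i => φ i < c) h2 fun i => ?_
    have := le_abs_self (φ i)
    have := neg_abs_le (φ i)
    rw [abs_of_nonneg hc]
    split_ifs with h
    · exact abs_le.2 ⟨by linarith, by linarith⟩
    · rw [abs_of_nonneg (sub_nonneg.2 (not_lt.1 h))]
      linarith
  · refine key (fun i => c < φ i) h1 fun i => ?_
    have := le_abs_self (φ i)
    have := neg_abs_le (φ i)
    rw [abs_of_nonpos hc]
    split_ifs with h
    · exact abs_le.2 ⟨by linarith, by linarith⟩
    · rw [abs_of_nonpos (sub_nonpos.2 (not_lt.1 h))]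
      linarith

namespace MetricGraph

variable {V E : Type*} (G : MetricGraph V E)

theorem eLpNorm_one_vertexMeasure (f : G.Point → ℝ) :
    eLpNorm f 1 G.vertexMeasure = ∑' v, ENNReal.ofReal (G.vmass v) * ‖f (.vertex v)‖ₑ := by
  rw [eLpNorm_one_eq_lintegral_enorm, lintegral_vertexMeasure]

theorem eLpNorm_two_vertexMeasure (f : G.Point → ℝ) :
    eLpNorm f 2 G.vertexMeasure =
      (∑' v, ENNReal.ofReal (G.vmass v) * ‖f (.vertex v)‖ₑ ^ (2 : ℝ)) ^ (1 / 2 : ℝ) := by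
  rw [eLpNorm_eq_lintegral_rpow_enorm_toReal two_ne_zero ENNReal.ofNat_ne_top,
    lintegral_vertexMeasure, ENNReal.toReal_ofNat]

/-- A Sobolev inequality for the square of `f`, from an isoperimetric inequality for the sets of
vertices at which `f` has constant sign. -/
theorem mul_Lp_sq_le_of_cutWeight {J : ℝ≥0∞} {q : ℝ} (hq0 : 0 < q) (hq1 : q ≤ 1)
    {f : G.Point → ℝ} (hf : G.IsC1 f) (W : Finset V) (hW : ∀ v, f (.vertex v) ≠ 0 → v ∈ W)
    (hJ : ∀ S : Finset V, ((∀ v ∈ S, 0 < f (.vertex v)) ∨ (∀ v ∈ S, f (.vertex v) < 0)) →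
      J * (∑ v ∈ S, ENNReal.ofReal (G.vmass v)) ^ q ≤ G.cutWeight S) :
    J * (∑ v ∈ W, ENNReal.ofReal (G.vmass v) * (‖f (.vertex v)‖ₑ ^ (2 : ℝ)) ^ q⁻¹) ^ q ≤
      eLpNorm (grad f) 2 G.edgeMeasure *
        (2 * G.rhoSup ^ (1 / 2 : ℝ) * eLpNorm f 2 G.vertexMeasure) := by
  have hp : 1 ≤ q⁻¹ := (one_le_inv₀ hq0).2 hq1
  have hpq : 1 / q⁻¹ = q := by rw [one_div, inv_inv]
  set φ : V → ℝ := fun v => f (.vertex v)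
  have hpos := G.mul_Lp_le_totalVariation (J := J) hp W (fun v => (φ v)⁺ ^ 2)
    (fun v => by positivity) (fun v h => hW v fun h0 => h (by simp [φ, h0])) fun S hS =>
      hpq.symm ▸ hJ S (.inl fun v hv => by
        by_contra h
        exact hS v hv (by rw [posPart_eq_zero.2 (not_lt.1 h), zero_pow two_ne_zero]))
  have hneg := G.mul_Lp_le_totalVariation (J := J) hp W (fun v => (φ v)⁻ ^ 2)
    (fun v => by positivity) (fun v h => hW v fun h0 => h (by simp [φ, h0])) fun S hS =>
      hpq.symm ▸ hJ S (.inr fun v hv => by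
        by_contra h
        exact hS v hv (by rw [negPart_eq_zero.2 (not_lt.1 h), zero_pow two_ne_zero]))
  rw [hpq] at hpos hneg
  have hsplit : ∀ v, (‖φ v‖ₑ ^ (2 : ℝ)) ^ q⁻¹ =
      ENNReal.ofReal ((φ v)⁺ ^ 2) ^ q⁻¹ + ENNReal.ofReal ((φ v)⁻ ^ 2) ^ q⁻¹ := by
    intro v
    have hq' : 0 < q⁻¹ := inv_pos.2 hq0
    have e : ‖φ v‖ₑ ^ (2 : ℝ) = ENNReal.ofReal (|φ v| ^ 2) := by
      rw [ENNReal.ofReal_pow (abs_nonneg _), ← Real.norm_eq_abs, ofReal_norm, ENNReal.rpow_two]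
    rw [e]
    rcases le_total 0 (φ v) with h | h
    · simp [posPart_of_nonneg h, negPart_eq_zero.2 h, hq']
    · simp [posPart_eq_zero.2 h, negPart_of_nonpos h, hq']
  calc _ ≤ J * ((∑ v ∈ W, ENNReal.ofReal (G.vmass v) * ENNReal.ofReal ((φ v)⁺ ^ 2) ^ q⁻¹) ^ q +
        (∑ v ∈ W, ENNReal.ofReal (G.vmass v) * ENNReal.ofReal ((φ v)⁻ ^ 2) ^ q⁻¹) ^ q) := by
        gcongr
        refine le_trans (le_of_eq ?_) (ENNReal.rpow_add_le_add_rpow _ _ hq0.le hq1)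
        rw [← Finset.sum_add_distrib]
        congr 1
        exact Finset.sum_congr rfl fun v _ => by rw [← mul_add, ← hsplit]
    _ ≤ G.totalVariation (fun v => (φ v)⁺ ^ 2) + G.totalVariation (fun v => (φ v)⁻ ^ 2) := by
        rw [mul_add]
        exact add_le_add hpos hneg
    _ ≤ _ := by
        refine le_trans ?_ (G.tsum_increment_mul_le hf)
        rw [totalVariation, totalVariation, ← ENNReal.tsum_add]
        refine ENNReal.tsum_le_tsum fun e => ?_
        rw [← mul_add, ← ENNReal.ofReal_add (abs_nonneg _) (abs_nonneg _)]
        gcongr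
        rw [add_comm ‖_‖ₑ, ← ofReal_norm, ← ofReal_norm, ← ENNReal.ofReal_add (norm_nonneg _)
          (norm_nonneg _), ← ENNReal.ofReal_mul (abs_nonneg _)]
        exact ENNReal.ofReal_le_ofReal (abs_posPart_sq_sub_add_abs_negPart_sq_sub_le _ _)

theorem nashInequality_of_cutWeight {ν J : ℝ≥0∞} (hν : 1 < ν) {f : G.Point → ℝ} (hf : G.IsC1 f)
    (hfin : {v | f (.vertex v) ≠ 0}.Finite)
    (hJ : ∀ S : Finset V, ((∀ v ∈ S, 0 < f (.vertex v)) ∨ (∀ v ∈ S, f (.vertex v) < 0)) →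
      J * (∑ v ∈ S, ENNReal.ofReal (G.vmass v)) ^ (1 - ν⁻¹.toReal) ≤ G.cutWeight S) :
    G.NashInequality (J * G.rhoSup ^ (-(1 / 2) : ℝ) / 2) ν f := by
  set a := ν⁻¹.toReal
  have ha0 : 0 ≤ a := ENNReal.toReal_nonneg
  have ha1 : a < 1 := ENNReal.toReal_inv_lt_one hν
  set W := hfin.toFinset
  have hW : ∀ v, v ∈ W ↔ f (.vertex v) ≠ 0 := fun v => hfin.mem_toFinset
  have hsob := G.mul_Lp_sq_le_of_cutWeight (sub_pos.2 ha1) (by linarith) hf W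
    (fun v => (hW v).2) hJ
  have hhol := ENNReal.sum_sq_rpow_le W (fun v => ENNReal.ofReal (G.vmass v))
    (fun v => ‖f (.vertex v)‖ₑ) ha0 ha1
  have h1 : eLpNorm f 1 G.vertexMeasure =
      ∑ v ∈ W, ENNReal.ofReal (G.vmass v) * ‖f (.vertex v)‖ₑ := by
    rw [eLpNorm_one_vertexMeasure]
    exact tsum_eq_sum fun v hv => by simp [not_not.1 (mt (hW v).2 hv)]
  have h2 : eLpNorm f 2 G.vertexMeasure =
      (∑ v ∈ W, ENNReal.ofReal (G.vmass v) * ‖f (.vertex v)‖ₑ ^ (2 : ℝ)) ^ (1 / 2 : ℝ) := by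
    rw [eLpNorm_two_vertexMeasure]
    congr 1
    exact tsum_eq_sum fun v hv => by simp [not_not.1 (mt (hW v).2 hv)]
  rw [NashInequality]
  set N1 := eLpNorm f 1 G.vertexMeasure
  set N2 := eLpNorm f 2 G.vertexMeasure
  set Q := (∑ v ∈ W, ENNReal.ofReal (G.vmass v) * (‖f (.vertex v)‖ₑ ^ (2 : ℝ)) ^ (1 - a)⁻¹)
    ^ (1 - a)
  rcases eq_or_ne N2 0 with hN2 | hN2
  · rw [hN2, ENNReal.zero_rpow_of_pos (by positivity)]
    simp
  have hN2' : N2 ≠ ∞ := by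
    rw [h2]
    exact ENNReal.rpow_ne_top_of_nonneg (by norm_num) (ENNReal.sum_ne_top.2 fun v _ =>
      ENNReal.mul_ne_top ENNReal.ofReal_ne_top
        (ENNReal.rpow_ne_top_of_nonneg zero_le_two enorm_ne_top))
  have hN1' : N1 ≠ ∞ := by
    rw [h1]
    exact ENNReal.sum_ne_top.2 fun v _ => ENNReal.mul_ne_top ENNReal.ofReal_ne_top enorm_ne_top
  have hN1 : N1 ≠ 0 := by
    intro h
    refine hN2 ?_
    rw [h1, Finset.sum_eq_zero_iff] at h
    rw [h2, Finset.sum_eq_zero, ENNReal.zero_rpow_of_pos (by norm_num)]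
    intro v hv
    rcases mul_eq_zero.1 (h v hv) with h | h <;> simp [h]
  have hpow : (∑ v ∈ W, ENNReal.ofReal (G.vmass v) * ‖f (.vertex v)‖ₑ ^ (2 : ℝ)) ^ (1 + a) =
      N2 ^ (1 + 2 * a) * N2 := by
    rw [show N2 ^ (1 + 2 * a) * N2 = N2 ^ (1 + 2 * a) * N2 ^ (1 : ℝ) by rw [ENNReal.rpow_one],
      ← ENNReal.rpow_add _ _ hN2 hN2', h2, ← ENNReal.rpow_mul]
    congr 1
    ring
  rw [hpow, ← h1] at hhol
  have hcancel : N1 ^ (-(2 * a)) * N1 ^ (2 * a) = 1 := by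
    rw [← ENNReal.rpow_add _ _ hN1 hN1']
    simp
  rw [mul_assoc]
  refine ENNReal.mul_rpow_neg_half_div_two_mul_le (mul_ne_zero ?_ ?_) ?_
  · exact (ENNReal.rpow_pos (pos_iff_ne_zero.2 hN2) hN2').ne'
  · exact (ENNReal.rpow_pos (pos_iff_ne_zero.2 hN1) hN1').ne'
  refine (ENNReal.mul_le_mul_iff_left hN2 hN2').1 ?_
  calc J * (N2 ^ (1 + 2 * a) * N1 ^ (-(2 * a))) * N2
      = J * (N1 ^ (-(2 * a)) * (N2 ^ (1 + 2 * a) * N2)) := by ring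
    _ ≤ J * (N1 ^ (-(2 * a)) * (N1 ^ (2 * a) * Q)) := by gcongr
    _ = J * Q := by rw [← mul_assoc (N1 ^ _), hcancel, one_mul]
    _ ≤ _ := hsob
    _ = _ := by ring

theorem isoConst_mul_le_cutWeight {ν : ℝ≥0∞} (hν : 1 < ν) (S : Finset V)
    (hE : {e | G.src e ∈ S ∨ G.tgt e ∈ S}.Finite) (hb : Disjoint (S : Set V) G.bdry) :
    G.isoConst ν * (∑ v ∈ S, ENNReal.ofReal (G.vmass v)) ^ (1 - ν⁻¹.toReal) ≤ G.cutWeight S := by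
  have hq : 0 < 1 - ν⁻¹.toReal := sub_pos.2 (ENNReal.toReal_inv_lt_one hν)
  have hc : (G.cutEdges S).Finite := hE.subset (G.cutEdges_subset S)
  have hm := G.vertexMeasure_thickening hc
  rw [Finset.tsum_subtype' S fun v => ENNReal.ofReal (G.vmass v)] at hm
  rcases eq_or_ne (∑ v ∈ S, ENNReal.ofReal (G.vmass v)) 0 with h0 | h0
  · rw [h0, ENNReal.zero_rpow_of_pos hq, mul_zero]
    exact zero_le
  have h := iInf₂_le (f := fun Ω (_ : G.Admissible Ω) => G.isoRatio ν Ω) _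
    (G.admissible_thickening S.finite_toSet hE hb)
  rw [isoRatio, hm, if_neg h0] at h
  exact (ENNReal.mul_le_of_le_div h).trans (G.boundaryArea_thickening_le hc)

theorem closedIsoConst_mul_le_cutWeight (hG : G.IsClosedGraph) {ν : ℝ≥0∞} (hν : 1 < ν)
    (S : Finset V)
    (hS : ∑ v ∈ S, ENNReal.ofReal (G.vmass v) ≤ G.vertexMeasure Set.univ / 2) :
    G.closedIsoConst ν * (∑ v ∈ S, ENNReal.ofReal (G.vmass v)) ^ (1 - ν⁻¹.toReal) ≤
      G.cutWeight S := by
  obtain ⟨hVfin, hEfin, hb⟩ := hG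
  have hq : 0 < 1 - ν⁻¹.toReal := sub_pos.2 (ENNReal.toReal_inv_lt_one hν)
  have hc : (G.cutEdges S).Finite := Set.toFinite _
  have hm := G.vertexMeasure_thickening hc
  rw [Finset.tsum_subtype' S fun v => ENNReal.ofReal (G.vmass v)] at hm
  set m := ∑ v ∈ S, ENNReal.ofReal (G.vmass v) with hmdef
  rcases eq_or_ne m 0 with h0 | h0
  · rw [h0, ENNReal.zero_rpow_of_pos hq, mul_zero]
    exact zero_le
  have hmtop : m ≠ ∞ := ENNReal.sum_ne_top.2 fun v _ => ENNReal.ofReal_ne_top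
  have hadd := measure_add_measure_compl (μ := G.vertexMeasure)
    (G.isOpen_thickening hc).measurableSet
  rw [hm] at hadd
  have hle : m ≤ G.vertexMeasure (G.thickening S)ᶜ := by
    rw [← hadd, ENNReal.le_div_iff_mul_le (.inl two_ne_zero) (.inl ENNReal.ofNat_ne_top),
      mul_two] at hS
    exact (ENNReal.add_le_add_iff_left hmtop).1 hS
  have h := iInf₂_le (f := fun Ω (_ : G.Admissible Ω) => G.closedIsoRatio ν Ω) _
    (G.admissible_thickening S.finite_toSet (Set.toFinite _) (by simp [hb]))
  rw [closedIsoRatio, hm, min_eq_left hle, if_neg h0] at h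
  refine (mul_le_mul_left h _).trans ?_
  rw [mul_assoc, ← ENNReal.rpow_add _ _ h0 hmtop]
  simpa [cutWeight] using G.boundaryArea_thickening_le hc

theorem sum_le_vertexMeasure {T : Set G.Point} (hT : MeasurableSet T) (S : Finset V)
    (hS : ∀ v ∈ S, .vertex v ∈ T) :
    ∑ v ∈ S, ENNReal.ofReal (G.vmass v) ≤ G.vertexMeasure T := by
  rw [G.vertexMeasure_apply hT]
  refine le_trans (le_of_eq ?_) (ENNReal.sum_le_tsum S)
  exact Finset.sum_congr rfl fun v hv => by simp [hS v hv]

theorem vertexMeasure_eq_ofReal_sum [Fintype V] {T : Set G.Point} (hT : MeasurableSet T)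
    [DecidablePred fun v : V => (.vertex v : G.Point) ∈ T] :
    G.vertexMeasure T = ENNReal.ofReal (∑ v with .vertex v ∈ T, G.vmass v) := by
  rw [G.vertexMeasure_apply hT, tsum_fintype,
    ENNReal.ofReal_sum_of_nonneg fun v _ => (G.vmass_pos v).le, Finset.sum_filter]
  refine Finset.sum_congr rfl fun v _ => ?_
  by_cases h : (.vertex v : G.Point) ∈ T <;> simp [h]

theorem nashInequality_of_isSplit (hG : G.IsClosedGraph) {ν : ℝ≥0∞} (hν : 1 < ν)
    {f : G.Point → ℝ} (hf : G.IsC1 f) (hs : IsSplit f) :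
    G.NashInequality (G.closedIsoConst ν * G.rhoSup ^ (-(1 / 2) : ℝ) / 2) ν f := by
  have := hG.1
  refine G.nashInequality_of_cutWeight hν hf (Set.toFinite _) fun S hS => ?_
  refine G.closedIsoConst_mul_le_cutWeight hG hν S ?_
  rcases hS with h | h
  · exact (G.sum_le_vertexMeasure (measurableSet_lt measurable_const hf.1.measurable) S h).trans
      hs.1
  · exact (G.sum_le_vertexMeasure (measurableSet_lt hf.1.measurable measurable_const) S h).trans
      hs.2

theorem exists_isSplit_sub [Fintype V] {f : G.Point → ℝ} (hf : Continuous f)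
    (h0 : ∫ x, f x ∂G.vertexMeasure = 0) :
    ∃ c : ℝ, IsSplit (fun x => f x - c) ∧
      eLpNorm (fun x => f x - c) 1 G.vertexMeasure ≤ eLpNorm f 1 G.vertexMeasure ∧
      eLpNorm f 2 G.vertexMeasure ≤ eLpNorm (fun x => f x - c) 2 G.vertexMeasure := by
  classical
  obtain ⟨c, h1, h2⟩ := exists_weighted_median G.vmass_pos fun v => f (.vertex v)
  have hpos : ∀ v, 0 ≤ G.vmass v := fun v => (G.vmass_pos v).le
  have hsum : ∑ v, G.vmass v * f (.vertex v) = 0 := by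
    rw [vertexMeasure, Measure.sum_fintype, integral_finsetSum_measure fun v _ =>
      (integrable_dirac (by simp)).smul_measure ENNReal.ofReal_ne_top] at h0
    simpa [integral_smul_measure, ENNReal.toReal_ofReal (hpos _)] using h0
  refine ⟨c, ⟨?_, ?_⟩, ?_, ?_⟩
  · rw [G.vertexMeasure_eq_ofReal_sum
      (measurableSet_lt measurable_const (hf.measurable.sub_const c)),
      G.vertexMeasure_eq_ofReal_sum .univ, ← ENNReal.ofReal_ofNat 2,
      ← ENNReal.ofReal_div_of_pos two_pos]
    refine ENNReal.ofReal_le_ofReal ?_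
    simpa using h1
  · rw [G.vertexMeasure_eq_ofReal_sum
      (measurableSet_lt (hf.measurable.sub_const c) measurable_const),
      G.vertexMeasure_eq_ofReal_sum .univ, ← ENNReal.ofReal_ofNat 2,
      ← ENNReal.ofReal_div_of_pos two_pos]
    refine ENNReal.ofReal_le_ofReal ?_
    simpa using h2
  · have e : ∀ g : G.Point → ℝ, eLpNorm g 1 G.vertexMeasure =
        ENNReal.ofReal (∑ v, G.vmass v * |g (.vertex v)|) := fun g => by
      rw [eLpNorm_one_vertexMeasure, tsum_fintype,
        ENNReal.ofReal_sum_of_nonneg fun v _ => mul_nonneg (hpos v) (abs_nonneg _)]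
      refine Finset.sum_congr rfl fun v _ => ?_
      rw [ENNReal.ofReal_mul (hpos v), ← Real.norm_eq_abs, ofReal_norm]
    rw [e, e]
    exact ENNReal.ofReal_le_ofReal (sum_mul_abs_sub_median_le G.vmass_pos _ h1 h2)
  · have e : ∀ g : G.Point → ℝ, eLpNorm g 2 G.vertexMeasure =
        ENNReal.ofReal (∑ v, G.vmass v * g (.vertex v) ^ 2) ^ (1 / 2 : ℝ) := fun g => by
      rw [eLpNorm_two_vertexMeasure, tsum_fintype,
        ENNReal.ofReal_sum_of_nonneg fun v _ => mul_nonneg (hpos v) (sq_nonneg _)]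
      congr 1
      refine Finset.sum_congr rfl fun v _ => ?_
      rw [ENNReal.ofReal_mul (hpos v), ← sq_abs, ENNReal.ofReal_pow (abs_nonneg _),
        ← Real.norm_eq_abs, ofReal_norm, ENNReal.rpow_two]
    rw [e, e]
    refine ENNReal.rpow_le_rpow (ENNReal.ofReal_le_ofReal ?_) (by norm_num)
    have expand : ∑ v, G.vmass v * (f (.vertex v) - c) ^ 2 =
        ∑ v, G.vmass v * f (.vertex v) ^ 2 - 2 * c * ∑ v, G.vmass v * f (.vertex v) +
          c ^ 2 * ∑ v, G.vmass v := by
      rw [Finset.mul_sum, Finset.mul_sum, ← Finset.sum_sub_distrib, ← Finset.sum_add_distrib]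
      exact Finset.sum_congr rfl fun v _ => by ring
    rw [expand, hsum]
    have : 0 ≤ c ^ 2 * ∑ v, G.vmass v :=
      mul_nonneg (sq_nonneg c) (Finset.sum_nonneg fun v _ => hpos v)
    linarith

variable {G} in
theorem grad_sub_const (f : G.Point → ℝ) (c : ℝ) : grad (fun x => f x - c) = grad f := by
  ext x
  cases x with
  | vertex v => rfl
  | inner e t ht => exact deriv_sub_const c

variable {G} in
theorem IsC1.sub_const {f : G.Point → ℝ} (hf : G.IsC1 f) (c : ℝ) :
    G.IsC1 fun x => f x - c := by
  refine ⟨hf.1.sub continuous_const, fun e => ⟨((hf.2 e).1).sub_const c, ?_⟩⟩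
  have : (deriv fun t => f (G.pt e t) - c) = deriv fun t => f (G.pt e t) :=
    funext fun t => deriv_sub_const c
  rw [this]
  exact (hf.2 e).2

end MetricGraph

end

theorem mainTheorem6 {V E : Type*} (G : MetricGraph V E) (ν : ℝ≥0∞) (hν : 2 < ν) :
    (∀ f : G.Point → ℝ, G.IsC1Dir f →
      G.NashInequality (G.isoConst ν * G.rhoSup ^ (-(1 / 2) : ℝ) / 2) ν f) ∧
    (G.IsClosedGraph → ∀ f : G.Point → ℝ, G.IsC1Dir f → MetricGraph.IsSplit f →
      G.NashInequality (G.closedIsoConst ν * G.rhoSup ^ (-(1 / 2) : ℝ) / 2) ν f) ∧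
    (G.IsClosedGraph → ∀ f : G.Point → ℝ, G.IsC1Dir f → ∫ x, f x ∂G.vertexMeasure = 0 →
      G.NashInequality (G.closedIsoConst ν * G.rhoSup ^ (-(1 / 2) : ℝ) / 2) ν f) := by
  have hν1 : 1 < ν := ENNReal.one_lt_two.trans hν
  refine ⟨fun f hf => ?_, fun hG f hf hs => G.nashInequality_of_isSplit hG hν1 hf.1 hs,
    fun hG f hf h0 => ?_⟩
  · refine G.nashInequality_of_cutWeight hν1 hf.1 (G.finite_vertex_support hf.2.1) fun S hS => ?_
    have hne : ∀ v ∈ S, f (.vertex v) ≠ 0 := fun v hv =>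
      hS.elim (fun h => (h v hv).ne') fun h => (h v hv).ne
    refine G.isoConst_mul_le_cutWeight hν1 S ?_ ?_
    · exact (G.finite_edge_support hf.1.1 hf.2.1).subset fun e he =>
        he.imp (hne _) (hne _)
    · exact Set.disjoint_left.2 fun v hv hb => hne v hv (hf.2.2 _ ⟨v, hb, rfl⟩)
  · have := hG.1
    have := Fintype.ofFinite V
    obtain ⟨c, hs, h1, h2⟩ := G.exists_isSplit_sub hf.1.1 h0
    have h := G.nashInequality_of_isSplit hG hν1 (hf.1.sub_const c) hs
    rw [MetricGraph.NashInequality, MetricGraph.grad_sub_const] at h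
    refine le_trans ?_ h
    have ha : 0 ≤ ν⁻¹.toReal := ENNReal.toReal_nonneg
    refine mul_le_mul' (by gcongr) ?_
    rw [ENNReal.rpow_neg, ENNReal.rpow_neg]
    gcongr
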